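/- **Conventions.** A vocabulary $V$ is a countable set of constant symbols, finitary function symbols and finitary predicate symbols. A real-valued structure $\mathcal M$ with vocabulary $V$ (a $V$-structure) has a non-empty universe $M$, elements $c^{\mathcal M}\in M$, functions $F^{\mathcal M}:M^n\to M$ and predicates $P^{\mathcal M}:M^n\to[0,1]$ interpreting the symbols of $V$. Continuous $V$-formulas are built from atomic formulas with arbitrary continuous functions $[0,1]^k\to[0,1]$ as connectives and with the quantifiers $\sup,\inf$; the value $0$ means truth. $\mathcal M\equiv\mathcal N$ means that every $V$-sentence has the same value in $\mathcal M$ and $\mathcal N$. $\mathrm{Th}(\mathcal M)$ is the set of $V$-sentences with value $0$ in $\mathcal M$; a continuous theory is a set of the form $\mathrm{Th}(\mathcal M)$, and a model of it is a $V$-structure in which all its sentences have value $0$. $\mathcal M$ is a metric structure if, for some binary predicate symbol $d\in V$ and some choice of a modulus of uniform continuity for each function and predicate symbol of $V$, $d^{\mathcal M}$ is a complete metric on $M$ and all symbols respect their moduli; a metric theory is $\mathrm{Th}(\mathcal M)$ for a metric structure $\mathcal M$. $\mathcal M$ is $\kappa$-saturated if for all $A\subseteq M$ with $|A|<\kappa$,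 every set of formulas in a finite tuple of variables with parameters from $A$, each of whose finite subsets is satisfied by some tuple of $\mathcal M$ (all formulas taking the value $0$), is satisfied by some tuple of $\mathcal M$. For an ultrafilter $\mathcal D$ over a set $I$ and $V$-structures $\mathcal M_t$ ($t\in I$), the pre-ultraproduct $\prod^{\mathcal D}\mathcal M_t$ is the $V$-structure with universe $\prod_{t\in I}M_t$ in which constants and functions are interpreted coordinatewise and predicates by $P(\vec a)=\lim_{\mathcal D}P^{\mathcal M_t}(\vec a[t])$; the ultraproduct is its reduction, i.e. its quotient by the relation $a\doteq b$ that no atomic formula with parameters takes different values at $a$ and $b$. The ultrapower of $\mathcal M$ is the ultraproduct with all $\mathcal M_t=\mathcal M$. $\mathcal D$ is regular if there is a family of $|I|$ sets in $\mathcal D$ such that each $t\in I$ belongs to only finitely many of them. A regular ultrafilter $\mathcal D$ over an infinite set $I$ with $|I|=\lambda$ saturates $\mathcal M$ if the ultrapower of $\mathcal M$ modulo $\mathcal D$ is $\lambda^+$-saturated; it saturates a continuous theory $T$ if it saturates every model of $T$. For continuous theories $T,U$ (possibly with different vocabularies), $T\trianglelefteq U$ means: for every model $\mathcal M$ of $T$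 and every model $\mathcal N$ of $U$, every regular ultrafilter (over any infinite set) that saturates $\mathcal N$ saturates $\mathcal M$. **Theorem.** 1. Let $\mathcal D$ be a regular ultrafilter over a set $I$ of infinite cardinality $\lambda$, and let $(\mathcal M_t)_{t\in I}$, $(\mathcal N_t)_{t\in I}$ be families of real-valued structures with the same vocabulary such that $\mathcal M_t\equiv\mathcal N_t$ for each $t\in I$. Then $\prod^{\mathcal D}\mathcal M_t$ is $\lambda^+$-saturated if and only if $\prod^{\mathcal D}\mathcal N_t$ is $\lambda^+$-saturated. 2. Let $T$ be a continuous theory and $\mathcal D$ a regular ultrafilter over an infinite set. Then for any two models $\mathcal M,\mathcal N$ of $T$, $\mathcal D$ saturates $\mathcal M$ if and only if $\mathcal D$ saturates $\mathcal N$; and $\mathcal D$ saturates $T$ if and only if $\mathcal D$ saturates some model of $T$. 3. $T\trianglelefteq T$ for every continuous theory $T$, and $\trianglelefteq$ is transitive; hence $\trianglelefteq$ is a pre-order on continuous theories. 4. For continuous theories $T,U$ the following are equivalent: (a) $T\trianglelefteq U$; (b) every regular ultrafilter over an infinite set that saturates $U$ saturates $T$; (c) there are a model $\mathcal M$ of $T$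 and a model $\mathcal N$ of $U$ such that every regular ultrafilter that saturates $\mathcal N$ saturates $\mathcal M$. 5. Let $\trianglelefteq_{m}$ be the relation between metric theories defined like $\trianglelefteq$, but with $\mathcal M,\mathcal N$ ranging only over models that are metric structures. Then $T\trianglelefteq_m T$ for every metric theory $T$, and for all metric theories $T,U$: $T\trianglelefteq_m U$ if and only if $T\trianglelefteq U$, and also if and only if there are metric structures $\mathcal M\models T$ and $\mathcal N\models U$ such that every regular ultrafilter that saturates $\mathcal N$ saturates $\mathcal M$. -/

import Mathlib

universe a b u w w' x

open FirstOrder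

namespace RealValued

/-! ### Real-valued structures

A vocabulary is a first-order language `L` (constant symbols are the function symbols of arity `0`)
with countably many symbols. -/

/-- A real-valued structure with vocabulary `L` on a non-empty universe set `M`; predicates take
values in the unit interval, where `0` stands for truth. -/
class RVStructure (L : FirstOrder.Language.{a, b}) (M : Type w) where
  nonempty : Nonempty M
  funMap : ∀ {n : ℕ}, L.Functions n → (Fin n → M) → M
  predMap : ∀ {n : ℕ}, L.Relations n → (Fin n → M) → unitInterval

/-- The value of a term under an assignment of the variables. -/
def termValue {L : FirstOrder.Language.{a, b}} {M : Type w} [RVStructure L M] {α : Type x} (v : α → M) :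
    L.Term α → M
  | .var i => v i
  | .func f ts => RVStructure.funMap f (fun i => termValue v (ts i))

/-! ### Continuous formulas -/

/-- Continuous formulas whose free variables are indexed by `α` together with `n` further
variables `0, …, n - 1` that can be quantified (a quantifier binds the last of them). Connectives
are arbitrary continuous functions of finitely many arguments on the unit interval. -/
inductive BFormula (L : FirstOrder.Language.{a, b}) (α : Type x) : ℕ → Type (max a b x)
  | pred {n l : ℕ} (P : L.Relations l) (ts : Fin l → L.Term (α ⊕ Fin n)) : BFormula L α n
  | connective {n k : ℕ} (c : C(Fin k → unitInterval, unitInterval))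
      (φs : Fin k → BFormula L α n) : BFormula L α n
  | sup {n : ℕ} (φ : BFormula L α (n + 1)) : BFormula L α n
  | inf {n : ℕ} (φ : BFormula L α (n + 1)) : BFormula L α n

/-- The truth value of a formula. -/
noncomputable def BFormula.value {L : FirstOrder.Language.{a, b}} {M : Type w} [RVStructure L M]
    {α : Type x} (v : α → M) : ∀ {n : ℕ}, BFormula L α n → (Fin n → M) → unitInterval
  | _, .pred P ts, xs => RVStructure.predMap P (fun i => termValue (Sum.elim v xs) (ts i))
  | _, .connective c φs, xs => c (fun i => (φs i).value v xs)
  | _, .sup φ, xs => ⨆ y : M, φ.value v (Fin.snoc xs y)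
  | _, .inf φ, xs => ⨅ y : M, φ.value v (Fin.snoc xs y)

/-- Continuous formulas with free variables indexed by `α`. -/
abbrev CFormula (L : FirstOrder.Language.{a, b}) (α : Type x) : Type (max a b x) := BFormula L α 0

/-- The truth value of a formula with free variables indexed by `α` at an `α`-tuple. -/
noncomputable def CFormula.truth {L : FirstOrder.Language.{a, b}} {M : Type w} [RVStructure L M]
    {α : Type x} (φ : CFormula L α) (v : α → M) : unitInterval :=
  BFormula.value v φ Fin.elim0

/-- Continuous sentences. -/
abbrev CSentence (L : FirstOrder.Language.{a, b}) : Type (max a b) := CFormula L Empty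

/-- The truth value of a sentence in a structure. -/
noncomputable def CSentence.truthIn {L : FirstOrder.Language.{a, b}} (φ : CSentence L) (M : Type w)
    [RVStructure L M] : unitInterval :=
  CFormula.truth (M := M) φ Empty.elim

/-- The theory of a structure: all sentences with truth value `0`. -/
def Th (L : FirstOrder.Language.{a, b}) (M : Type w) [RVStructure L M] : Set (CSentence L) :=
  {φ | CSentence.truthIn φ M = 0}

/-- Elementary equivalence: every sentence has the same truth value in both structures. -/
def ElemEquiv (L : FirstOrder.Language.{a, b}) (M : Type w) (N : Type x) [RVStructure L M]
    [RVStructure L N] : Prop :=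
  ∀ φ : CSentence L, CSentence.truthIn φ M = CSentence.truthIn φ N

/-! ### Saturation -/

/-- A formula with parameters from `A` in the variables `0, …, n - 1`: a formula in which some of
the free variables are replaced by elements of `A`. A set of such formulas is satisfiable if
a single `n`-tuple gives all its members the value `0`. -/
def Satisfiable {L : FirstOrder.Language.{a, b}} {M : Type w} [RVStructure L M] {A : Set M} {n : ℕ}
    (Γ : Set (CFormula L (A ⊕ Fin n))) : Prop :=
  ∃ c : Fin n → M, ∀ φ ∈ Γ, CFormula.truth φ (Sum.elim (fun p : A => (p : M)) c) = 0

/-- Every finite subset is satisfiable. -/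
def FinitelySatisfiable {L : FirstOrder.Language.{a, b}} {M : Type w} [RVStructure L M] {A : Set M} {n : ℕ}
    (Γ : Set (CFormula L (A ⊕ Fin n))) : Prop :=
  ∀ Δ ⊆ Γ, Δ.Finite → Satisfiable Δ

/-- `κ`-saturation: every finitely satisfiable set of formulas in a finite tuple of variables, with
parameters from a set of cardinality less than `κ`, is satisfiable. -/
def IsSaturated (L : FirstOrder.Language.{a, b}) (M : Type w) [RVStructure L M] (κ : Cardinal.{w}) : Prop :=
  ∀ A : Set M, Cardinal.mk A < κ → ∀ (n : ℕ) (Γ : Set (CFormula L (A ⊕ Fin n))),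
    FinitelySatisfiable Γ → Satisfiable Γ

/-! ### Reductions -/

/-- The Leibniz relation: `p` and `q` cannot be told apart by an atomic formula with parameters.
The variable `0` of the atomic formula is the one that `p` and `q` are substituted for. -/
def Leibniz (L : FirstOrder.Language.{a, b}) {M : Type w} [RVStructure L M] (p q : M) : Prop :=
  ∀ (n l : ℕ) (P : L.Relations l) (ts : Fin l → L.Term (Fin (n + 1))) (c : Fin n → M),
    RVStructure.predMap P (fun i => termValue (Fin.cons p c : Fin (n + 1) → M) (ts i)) =
      RVStructure.predMap P (fun i => termValue (Fin.cons q c : Fin (n + 1) → M) (ts i))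

/-- The Leibniz relation is an equivalence relation. -/
def leibnizSetoid (L : FirstOrder.Language.{a, b}) (M : Type w) [RVStructure L M] : Setoid M where
  r := Leibniz L
  iseqv :=
    { refl := fun _ _ _ _ _ _ => rfl
      symm := fun h n l P ts c => (h n l P ts c).symm
      trans := fun h k n l P ts c => (h n l P ts c).trans (k n l P ts c) }

/-- The universe of the reduction: the set of classes of the Leibniz relation. -/
def Reduction (L : FirstOrder.Language.{a, b}) (M : Type w) [RVStructure L M] : Type w :=
  Quotient (leibnizSetoid L M)

/-- The reduction map. -/
def Reduction.mk (L : FirstOrder.Language.{a, b}) {M : Type w} [RVStructure L M] (p : M) : Reduction L M :=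
  Quotient.mk (leibnizSetoid L M) p

/-- A representative of a class. -/
noncomputable def Reduction.rep {L : FirstOrder.Language.{a, b}} {M : Type w} [RVStructure L M]
    (p : Reduction L M) : M :=
  Quotient.out p

theorem Reduction.mk_eq_mk {L : FirstOrder.Language.{a, b}} {M : Type w} [RVStructure L M] {p q : M} :
    Reduction.mk L p = Reduction.mk L q ↔ Leibniz L p q :=
  Quotient.eq

theorem Reduction.mk_rep {L : FirstOrder.Language.{a, b}} {M : Type w} [RVStructure L M]
    (p : Reduction L M) : Reduction.mk L p.rep = p :=
  Quotient.out_eq p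

/-- The structure on the reduction, computed on representatives; `Reduction.funMap_mk` and
`Reduction.predMap_mk` show that the choice of the representatives does not matter. -/
noncomputable instance (L : FirstOrder.Language.{a, b}) (M : Type w) [RVStructure L M] :
    RVStructure L (Reduction L M) where
  nonempty := (RVStructure.nonempty L (M := M)).map (Reduction.mk L)
  funMap f p := Reduction.mk L (RVStructure.funMap f (fun i => (p i).rep))
  predMap P p := RVStructure.predMap P (fun i => (p i).rep)

theorem termValue_relabel {L : FirstOrder.Language.{a, b}} {M : Type w} [RVStructure L M] {α β : Type*}
    (g : α → β) (v : β → M) (t : L.Term α) : termValue v (t.relabel g) = termValue (v ∘ g) t := by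
  induction t with
  | var i => rfl
  | func f ts ih => simp only [FirstOrder.Language.Term.relabel, termValue, ih]

theorem termValue_subst {L : FirstOrder.Language.{a, b}} {M : Type w} [RVStructure L M] {α β : Type*}
    (s : α → L.Term β) (v : β → M) (t : L.Term α) :
    termValue v (t.subst s) = termValue (fun i => termValue v (s i)) t := by
  induction t with
  | var i => rfl
  | func f ts ih => simp only [FirstOrder.Language.Term.subst, termValue, ih]

/-- Replacing all variables by Leibniz-equivalent elements does not change an atomic formula. -/
theorem Leibniz.pred_eq {L : FirstOrder.Language.{a, b}} {M : Type w} [RVStructure L M] {m l : ℕ}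
    (P : L.Relations l) (ts : Fin l → L.Term (Fin m)) {v v' : Fin m → M}
    (h : ∀ i, Leibniz L (v i) (v' i)) :
    RVStructure.predMap P (fun i => termValue v (ts i)) =
      RVStructure.predMap P (fun i => termValue v' (ts i)) := by
  classical
  have one : ∀ (y : Fin m → M) (j : Fin m) (p : M), Leibniz L p (y j) →
      RVStructure.predMap P (fun i => termValue (Function.update y j p) (ts i)) =
        RVStructure.predMap P (fun i => termValue y (ts i)) := by
    intro y j p hp
    have key := hp m l P
      (fun i => (ts i).relabel (fun k : Fin m => if k = j then (0 : Fin (m + 1)) else k.succ)) y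
    simp only [termValue_relabel] at key
    have e : ∀ q : M, (Fin.cons q y : Fin (m + 1) → M) ∘
        (fun k : Fin m => if k = j then (0 : Fin (m + 1)) else k.succ) =
          Function.update y j q := by
      intro q
      funext k
      by_cases hk : k = j
      · subst hk; simp
      · simp [hk]
    rw [e, e, Function.update_eq_self] at key
    exact key
  have all : ∀ s : Finset (Fin m),
      RVStructure.predMap P (fun i => termValue (fun k => if k ∈ s then v k else v' k) (ts i)) =
        RVStructure.predMap P (fun i => termValue v' (ts i)) := by
    intro s
    induction s using Finset.induction_on with
    | empty => simp
    | insert j s hj ih =>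
      rw [← ih]
      have e : (fun k => if k ∈ insert j s then v k else v' k) =
          Function.update (fun k => if k ∈ s then v k else v' k) j (v j) := by
        funext k
        by_cases hk : k = j
        · subst hk; simp
        · simp [hk]
      rw [e]
      apply one
      simpa [hj] using h j
  simpa using all Finset.univ

/-- The Leibniz relation is a congruence for the function symbols. -/
theorem Leibniz.funMap {L : FirstOrder.Language.{a, b}} {M : Type w} [RVStructure L M] {k : ℕ}
    (f : L.Functions k) {v v' : Fin k → M} (h : ∀ i, Leibniz L (v i) (v' i)) :
    Leibniz L (RVStructure.funMap f v) (RVStructure.funMap f v') := by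
  intro n l P ts c
  let s : Fin (n + 1) → L.Term (Fin (k + n)) :=
    Fin.cons (FirstOrder.Language.Term.func f (fun i => FirstOrder.Language.Term.var (Fin.castAdd n i)))
      (fun j => FirstOrder.Language.Term.var (Fin.natAdd k j))
  have e : ∀ y : Fin k → M, (fun i => termValue (Fin.append y c) (s i)) =
      (Fin.cons (RVStructure.funMap f y) c : Fin (n + 1) → M) := by
    intro y
    funext i
    refine Fin.cases ?_ (fun j => ?_) i
    · simp [s, termValue]
    · simp [s, termValue]
  have key := Leibniz.pred_eq P (fun i => (ts i).subst s) (v := Fin.append v c)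
    (v' := Fin.append v' c) (by
      intro i
      refine Fin.addCases (fun j => ?_) (fun j => ?_) i
      · simpa using h j
      · simp only [Fin.append_right]
        exact fun _ _ _ _ _ => rfl)
  simp only [termValue_subst, e] at key
  exact key

theorem Reduction.leibniz_rep {L : FirstOrder.Language.{a, b}} {M : Type w} [RVStructure L M] (p : M) :
    Leibniz L (Reduction.mk L p).rep p :=
  Reduction.mk_eq_mk.1 (Reduction.mk_rep _)

theorem Reduction.funMap_mk {L : FirstOrder.Language.{a, b}} {M : Type w} [RVStructure L M] {k : ℕ}
    (f : L.Functions k) (v : Fin k → M) :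
    RVStructure.funMap f (fun i => Reduction.mk L (v i)) =
      Reduction.mk L (RVStructure.funMap f v) :=
  Reduction.mk_eq_mk.2 (Leibniz.funMap f (fun i => Reduction.leibniz_rep (v i)))

theorem Reduction.predMap_mk {L : FirstOrder.Language.{a, b}} {M : Type w} [RVStructure L M] {k : ℕ}
    (P : L.Relations k) (v : Fin k → M) :
    RVStructure.predMap P (fun i => Reduction.mk L (v i)) = RVStructure.predMap P v :=
  Leibniz.pred_eq P (fun i => FirstOrder.Language.Term.var i) (fun i => Reduction.leibniz_rep (v i))

/-! ### Ultraproducts -/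

/-- The limit of a function into the unit interval along an ultrafilter. -/
noncomputable def ultraLim {I : Type u} (D : Ultrafilter I) (r : I → unitInterval) :
    unitInterval :=
  (D.map r).lim

/-- The limit is the unique point all of whose neighbourhoods are `D`-almost always visited. -/
theorem ultraLim_eq_iff {I : Type u} (D : Ultrafilter I) (r : I → unitInterval)
    (s : unitInterval) :
    ultraLim D r = s ↔ ∀ ε : ℝ, 0 < ε → {t | |(r t : ℝ) - s| < ε} ∈ D := by
  unfold ultraLim
  rw [Ultrafilter.lim_eq_iff_le_nhds]
  change Filter.Tendsto r D (nhds s) ↔ _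
  rw [Metric.tendsto_nhds]
  rfl

/-- The universe of the pre-ultraproduct: the full cartesian product. -/
def PreUltraproduct {I : Type u} (_D : Ultrafilter I) (M : I → Type w) : Type (max u w) :=
  ∀ t, M t

/-- The pre-ultraproduct: functions act coordinatewise, predicates are limits along `D`. -/
noncomputable instance (L : FirstOrder.Language.{a, b}) {I : Type u} (D : Ultrafilter I) (M : I → Type w)
    [∀ t, RVStructure L (M t)] : RVStructure L (PreUltraproduct D M) where
  nonempty := ⟨fun t => (RVStructure.nonempty L (M := M t)).some⟩
  funMap f p := fun t => RVStructure.funMap f (fun i => p i t)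
  predMap P p := ultraLim D (fun t => RVStructure.predMap P (fun i => p i t))

/-- The ultraproduct: the reduction of the pre-ultraproduct. -/
abbrev Ultraproduct (L : FirstOrder.Language.{a, b}) {I : Type u} (D : Ultrafilter I) (M : I → Type w)
    [∀ t, RVStructure L (M t)] : Type (max u w) :=
  Reduction L (PreUltraproduct D M)

/-- A regular ultrafilter over `I`: there is a family of `|I|` sets in `D` such that each point
of `I` lies in only finitely many of them. -/
def IsRegularUltrafilter {I : Type u} (D : Ultrafilter I) : Prop :=
  ∃ X : Set (Set I), (∀ S ∈ X, S ∈ D) ∧ Cardinal.mk X = Cardinal.mk I ∧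
    ∀ t : I, {S ∈ X | t ∈ S}.Finite

/-- The successor cardinal `λ⁺` of `λ = |I|`, in the universe of the products over `I`. -/
noncomputable def succCard (I : Type u) : Cardinal.{max u w} :=
  Order.succ (Cardinal.lift.{w} (Cardinal.mk I))

/-- `D` saturates `M`: the ultrapower of `M` is `λ⁺`-saturated, where `λ = |I|`. -/
def Saturates {I : Type u} (D : Ultrafilter I) (L : FirstOrder.Language.{a, b}) (M : Type w)
    [RVStructure L M] : Prop :=
  IsSaturated L (Ultraproduct L D (fun _ : I => M)) (succCard.{u, w} I)

/-! ### Metric structures -/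

/-- A metric signature over `L`: a distance predicate and a modulus of uniform continuity for each
function symbol and each predicate symbol. -/
structure MetricSignature (L : FirstOrder.Language.{a, b}) where
  dist : L.Relations 2
  funModulus : ∀ {n : ℕ}, L.Functions n → ℝ → ℝ
  predModulus : ∀ {n : ℕ}, L.Relations n → ℝ → ℝ
  funModulus_pos : ∀ {n : ℕ} (f : L.Functions n) (ε : ℝ), 0 < ε → 0 < funModulus f ε
  predModulus_pos : ∀ {n : ℕ} (P : L.Relations n) (ε : ℝ), 0 < ε → 0 < predModulus P ε

/-- The distance between two elements, as a real number. -/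
def MetricSignature.d {L : FirstOrder.Language.{a, b}} (S : MetricSignature L) {M : Type w}
    [RVStructure L M] (p q : M) : ℝ :=
  (RVStructure.predMap S.dist ![p, q] : unitInterval)

/-- `M` is a metric structure for the signature `S`: the distance predicate is a complete metric and
all symbols respect their moduli of uniform continuity. -/
structure MetricSignature.IsMetric {L : FirstOrder.Language.{a, b}} (S : MetricSignature L) (M : Type w)
    [RVStructure L M] : Prop where
  d_eq_zero : ∀ p q : M, S.d p q = 0 ↔ p = q
  symm : ∀ p q : M, S.d p q = S.d q p
  triangle : ∀ p q r : M, S.d p r ≤ S.d p q + S.d q r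
  complete : ∀ s : ℕ → M,
    (∀ ε : ℝ, 0 < ε → ∃ k, ∀ i ≥ k, ∀ j ≥ k, S.d (s i) (s j) < ε) →
      ∃ p : M, ∀ ε : ℝ, 0 < ε → ∃ k, ∀ i ≥ k, S.d (s i) p < ε
  fun_unifCont : ∀ {n : ℕ} (f : L.Functions n) (ε : ℝ), 0 < ε → ∀ p q : Fin n → M,
    (∀ i, S.d (p i) (q i) < S.funModulus f ε) →
      S.d (RVStructure.funMap f p) (RVStructure.funMap f q) ≤ ε
  pred_unifCont : ∀ {n : ℕ} (P : L.Relations n) (ε : ℝ), 0 < ε → ∀ p q : Fin n → M,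
    (∀ i, S.d (p i) (q i) < S.predModulus P ε) →
      |(RVStructure.predMap P p : ℝ) - (RVStructure.predMap P q : ℝ)| ≤ ε

/-- A metric structure: a structure that is metric for some signature over its vocabulary. -/
def IsMetricStructure (L : FirstOrder.Language.{a, b}) (M : Type w) [RVStructure L M] : Prop :=
  ∃ S : MetricSignature L, S.IsMetric M

/-! ### Theories and the order on them -/

/-- A continuous theory: a countable vocabulary together with a set of sentences that is the theory
of some real-valued structure with that vocabulary. -/
structure ContinuousTheory where
  L : FirstOrder.Language.{a, b}
  countable : Countable L.Symbols
  sentences : Set (CSentence L)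
  exists_structure : ∃ (M : Type w) (_ : RVStructure L M), sentences = Th L M

/-- A metric theory: the theory of some metric structure. -/
def ContinuousTheory.IsMetricTheory (T : ContinuousTheory.{a, b, w}) : Prop :=
  ∃ (M : Type w) (_ : RVStructure T.L M), IsMetricStructure T.L M ∧ T.sentences = Th T.L M

/-- `M` is a model of `T`: all sentences of `T` have the value `0` in `M`. -/
def ContinuousTheory.IsModel (T : ContinuousTheory.{a, b, w}) (M : Type w)
    [RVStructure T.L M] : Prop :=
  ∀ φ ∈ T.sentences, CSentence.truthIn φ M = 0

/-- `D` saturates `T`: it saturates every model of `T`. -/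
def SaturatesTheory {I : Type u} (D : Ultrafilter I) (T : ContinuousTheory.{a, b, w}) : Prop :=
  ∀ (M : Type w) [RVStructure T.L M], T.IsModel M → Saturates D T.L M

/-- Every regular ultrafilter (over an infinite set) that saturates `N` saturates `M`. -/
def SaturatedWhenever (L : FirstOrder.Language.{a, b}) (M : Type w) [RVStructure L M]
    (L' : FirstOrder.Language.{a, b}) (N : Type w) [RVStructure L' N] : Prop :=
  ∀ (I : Type u) [Infinite I] (D : Ultrafilter I), IsRegularUltrafilter D →
    Saturates D L' N → Saturates D L M

/-- The relation `T ⊴ U`: for all models `M` of `T` and `N` of `U`, every regular ultrafilter that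
saturates `N` saturates `M`. -/
def TriangleLE (T U : ContinuousTheory.{a, b, w}) : Prop :=
  ∀ (M : Type w) [RVStructure T.L M] (N : Type w) [RVStructure U.L N],
    T.IsModel M → U.IsModel N → SaturatedWhenever.{a, b, u, w} T.L M U.L N

/-- The relation `T ⊴ U` between metric theories, where only metric models are considered. -/
def MetricTriangleLE (T U : ContinuousTheory.{a, b, w}) : Prop :=
  ∀ (M : Type w) [RVStructure T.L M] (N : Type w) [RVStructure U.L N],
    T.IsModel M → IsMetricStructure T.L M → U.IsModel N → IsMetricStructure U.L N →
      SaturatedWhenever.{a, b, u, w} T.L M U.L N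

end RealValued

open RealValued

/-!
Saturation of a pre-ultraproduct modulo a regular ultrafilter depends only on the theories of the
factors. Let `∏ M t` be `λ⁺`-saturated, let `M t ≡ N t`, and let `Γ` be a finitely satisfiable type
in `∏ N t` over at most `λ` parameters.

Connectives can be approximated uniformly by those from a countable dense set, so the formulas over
the parameters have a dense subset of cardinality at most `λ` (`exists_small_dense`), and `Γ` may be
assumed to have at most `λ` members (`exists_small_type`). The conditions `φ ≤ 1 / (k + 1)` with
`φ ∈ Γ` and `k : ℕ` are then at most `λ` in number, and regularity distributes them over the index
set so that each index `t` receives finitely many and each condition goes to almost all indices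
(`IsRegularUltrafilter.exists_finset`). For a finite set of conditions one formula in the parameters
alone measures how far it is from being satisfiable (`satFormula`). Only finitely many such formulas
occur at `t`, so by elementary equivalence there are elements of `M t` at which they take almost the
values that they take at the parameters in `N t` (`ElemEquiv.exists_near`). These elements form
parameters in `∏ M t`. By the theorem of Łoś (`PreUltraproduct.value_eq`) the type over the new
parameters is approximately finitely satisfiable, hence realized by saturation. At each `t` the
conditions that the realization meets in `M t` are jointly satisfiable there, so nearly satisfiable
in `N t`; the witnesses in `N t` make up a realization of `Γ` (`exists_transfer_parameters`).

Passing to the reduction does not affect truth values, hence neither saturation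
(`isSaturated_reduction_iff`). All models of a continuous theory are elementarily equivalent, so a
regular ultrafilter saturates one of them if and only if it saturates all
(`Saturates.of_isModel`). The statements about the order on theories follow, as every continuous
theory has a model and every metric theory has a metric model.
-/

namespace RealValued

open Filter Topology Cardinal

variable {L : FirstOrder.Language.{a, b}}

/-! ### Suprema and infima in the unit interval -/

theorem coe_iSup_le {ι : Sort*} {f : ι → unitInterval} {r : ℝ} (hr : 0 ≤ r)
    (h : ∀ i, (f i : ℝ) ≤ r) : ((⨆ i, f i : unitInterval) : ℝ) ≤ r := by
  rcases le_total r 1 with h1 | h1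
  · have : (⨆ i, f i) ≤ (⟨r, hr, h1⟩ : unitInterval) := iSup_le fun i => h i
    exact this
  · exact (unitInterval.le_one _).trans h1

theorem le_coe_iInf {ι : Sort*} {f : ι → unitInterval} {r : ℝ} (hr : r ≤ 1)
    (h : ∀ i, r ≤ f i) : r ≤ ((⨅ i, f i : unitInterval) : ℝ) := by
  rcases le_total 0 r with h1 | h1
  · have : (⟨r, h1, hr⟩ : unitInterval) ≤ ⨅ i, f i := le_iInf fun i => h i
    exact this
  · exact h1.trans (unitInterval.nonneg _)

theorem coe_le_iSup {ι : Sort*} (f : ι → unitInterval) (i : ι) :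
    (f i : ℝ) ≤ ((⨆ i, f i : unitInterval) : ℝ) :=
  le_iSup f i

theorem iInf_le_coe {ι : Sort*} (f : ι → unitInterval) (i : ι) :
    ((⨅ i, f i : unitInterval) : ℝ) ≤ f i :=
  iInf_le f i

theorem exists_coe_lt_iInf_add {ι : Sort*} [Nonempty ι] (f : ι → unitInterval) {ε : ℝ}
    (hε : 0 < ε) : ∃ i, (f i : ℝ) < ((⨅ i, f i : unitInterval) : ℝ) + ε := by
  by_contra! h
  have := le_coe_iInf ((h (Classical.arbitrary ι)).trans (unitInterval.le_one _)) h
  linarith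

theorem exists_iSup_lt_coe_add {ι : Sort*} [Nonempty ι] (f : ι → unitInterval) {ε : ℝ}
    (hε : 0 < ε) : ∃ i, ((⨆ i, f i : unitInterval) : ℝ) < f i + ε := by
  by_contra! h
  have h' : ∀ i, (f i : ℝ) ≤ ((⨆ i, f i : unitInterval) : ℝ) - ε := fun i => by linarith [h i]
  have := coe_iSup_le ((unitInterval.nonneg _).trans (h' (Classical.arbitrary ι))) h'
  linarith

theorem abs_iSup_sub_iSup_le {ι : Sort*} {f g : ι → unitInterval} {ε : ℝ} (hε : 0 ≤ ε)
    (h : ∀ i, |(f i : ℝ) - g i| ≤ ε) :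
    |((⨆ i, f i : unitInterval) : ℝ) - ((⨆ i, g i : unitInterval) : ℝ)| ≤ ε := by
  rw [abs_sub_le_iff, sub_le_iff_le_add, sub_le_iff_le_add]
  constructor
  · refine coe_iSup_le (add_nonneg hε (unitInterval.nonneg _)) fun i => ?_
    linarith [(abs_sub_le_iff.1 (h i)).1, coe_le_iSup g i]
  · refine coe_iSup_le (add_nonneg hε (unitInterval.nonneg _)) fun i => ?_
    linarith [(abs_sub_le_iff.1 (h i)).2, coe_le_iSup f i]

theorem abs_iInf_sub_iInf_le {ι : Sort*} {f g : ι → unitInterval} {ε : ℝ} (hε : 0 ≤ ε)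
    (h : ∀ i, |(f i : ℝ) - g i| ≤ ε) :
    |((⨅ i, f i : unitInterval) : ℝ) - ((⨅ i, g i : unitInterval) : ℝ)| ≤ ε := by
  have key : ∀ {f g : ι → unitInterval}, (∀ i, |(f i : ℝ) - g i| ≤ ε) →
      ((⨅ i, f i : unitInterval) : ℝ) - ε ≤ ((⨅ i, g i : unitInterval) : ℝ) := by
    intro f g h
    refine le_coe_iInf (by linarith [unitInterval.le_one (⨅ i, f i)]) fun i => ?_
    linarith [(abs_sub_le_iff.1 (h i)).1, iInf_le_coe f i]
  rw [abs_sub_le_iff]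
  constructor
  · linarith [key h]
  · linarith [key (f := g) (g := f) fun i => by rw [abs_sub_comm]; exact h i]

/-! ### Operations on formulas -/

/-- Substitution of variables: each free variable becomes a free variable or one of `m` new
quantifiable variables, which are put in front of the `n` old ones. -/
def BFormula.bind {α : Type x} {β : Type w} {m : ℕ} (f : α → β ⊕ Fin m) :
    ∀ {n : ℕ}, BFormula L α n → BFormula L β (m + n)
  | n, .pred P ts => .pred P fun i =>
      (ts i).relabel (Sum.elim (Sum.map id (Fin.castAdd n) ∘ f) (Sum.inr ∘ Fin.natAdd m))
  | _, .connective c φs => .connective c fun i => (φs i).bind f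
  | _, .sup φ => .sup (φ.bind f)
  | _, .inf φ => .inf (φ.bind f)

theorem BFormula.value_bind {M : Type u} [RVStructure L M] {α : Type x} {β : Type w} {m n : ℕ}
    (f : α → β ⊕ Fin m) (φ : BFormula L α n) (v : β → M) (xs : Fin m → M) (ys : Fin n → M) :
    (φ.bind f).value v (Fin.append xs ys) = φ.value (Sum.elim v xs ∘ f) ys := by
  induction φ with
  | pred P ts =>
    simp only [bind, value, termValue_relabel]
    congr 1
    funext i
    congr 1
    funext j
    rcases j with j | j
    · rcases h : f j with k | k <;> simp [h]
    · simp
  | connective c φs ih => simp only [bind, value, ih]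
  | sup φ ih =>
    simp only [bind, value, ← ih, Fin.append_snoc]
  | inf φ ih =>
    simp only [bind, value, ← ih, Fin.append_snoc]

/-- Renaming of the free variables. -/
def CFormula.relabel {α : Type x} {β : Type w} (g : α → β) (φ : CFormula L α) : CFormula L β :=
  BFormula.bind (m := 0) (n := 0) (fun i => Sum.inl (g i)) φ

theorem CFormula.truth_relabel {M : Type u} [RVStructure L M] {α : Type x} {β : Type w}
    (g : α → β) (φ : CFormula L α) (v : β → M) :
    (φ.relabel g).truth v = φ.truth (v ∘ g) := by
  unfold CFormula.truth CFormula.relabel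
  rw [← show Sum.elim v Fin.elim0 ∘ (fun i => Sum.inl (g i)) = v ∘ g from rfl,
    ← BFormula.value_bind]
  congr 1
  funext i
  exact i.elim0

/-- Infimum over all quantifiable variables. -/
def BFormula.infAll {α : Type x} : ∀ {n : ℕ}, BFormula L α n → CFormula L α
  | 0, φ => φ
  | _ + 1, φ => BFormula.infAll (.inf φ)

theorem BFormula.truth_infAll {M : Type u} [RVStructure L M] {α : Type x} {n : ℕ}
    (φ : BFormula L α n) (v : α → M) :
    CFormula.truth φ.infAll v = ⨅ xs : Fin n → M, φ.value v xs := by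
  induction n with
  | zero =>
    rw [iInf_unique]
    simp only [infAll, CFormula.truth]
    congr 1
  | succ n ih =>
    rw [infAll, ih]
    simp only [value]
    apply le_antisymm
    · refine le_iInf fun zs => ?_
      refine (iInf_le _ (Fin.init zs)).trans ((iInf_le _ (zs (Fin.last n))).trans ?_)
      rw [Fin.snoc_init_self]
    · exact le_iInf fun xs => le_iInf fun y => iInf_le _ _

/-- Infimum over the last `n` of the free variables. -/
def CFormula.infVars {α : Type x} {n : ℕ} (φ : CFormula L (α ⊕ Fin n)) : CFormula L α :=
  BFormula.infAll (BFormula.bind (m := n) (n := 0) id φ)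

theorem CFormula.truth_infVars {M : Type u} [RVStructure L M] {α : Type x} {n : ℕ}
    (φ : CFormula L (α ⊕ Fin n)) (v : α → M) :
    φ.infVars.truth v = ⨅ c : Fin n → M, φ.truth (Sum.elim v c) := by
  unfold infVars
  rw [BFormula.truth_infAll]
  congr 1
  funext c
  have := BFormula.value_bind id φ v c Fin.elim0
  rw [Fin.append_elim0] at this
  exact this

/-- A connective whose arguments are indexed by a finite type. -/
noncomputable def BFormula.finConnective {α : Type x} {n : ℕ} {ι : Type u} [Fintype ι]
    (c : C(ι → unitInterval, unitInterval)) (φs : ι → BFormula L α n) : BFormula L α n :=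
  .connective
    (c.comp ⟨fun y i => y (Fintype.equivFin ι i), by fun_prop⟩)
    fun k => φs ((Fintype.equivFin ι).symm k)

theorem BFormula.value_finConnective {M : Type w} [RVStructure L M] {α : Type x} {n : ℕ}
    {ι : Type u} [Fintype ι] (c : C(ι → unitInterval, unitInterval)) (φs : ι → BFormula L α n)
    (v : α → M) (xs : Fin n → M) :
    (finConnective c φs).value v xs = c fun i => (φs i).value v xs := by
  simp [finConnective, value]

/-- The value of a term depends on finitely many variables only. -/
theorem termValue_congr_finite {M : Type u} [RVStructure L M] {α : Type x} (t : L.Term α) :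
    ∃ s : Finset α, ∀ v v' : α → M, (∀ i ∈ s, v i = v' i) → termValue v t = termValue v' t := by
  classical
  induction t with
  | var i => exact ⟨{i}, fun v v' h => h i (by simp)⟩
  | func f ts ih =>
    choose s hs using ih
    refine ⟨Finset.univ.biUnion s, fun v v' h => ?_⟩
    simp only [termValue]
    congr 1
    funext i
    exact hs i v v' fun j hj => h j (Finset.mem_biUnion.2 ⟨i, Finset.mem_univ i, hj⟩)

theorem BFormula.value_congr_finite (M : Type u) [RVStructure L M] {α : Type x} {n : ℕ}
    (φ : BFormula L α n) :
    ∃ s : Finset α, ∀ v v' : α → M, (∀ i ∈ s, v i = v' i) →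
      ∀ xs, φ.value v xs = φ.value v' xs := by
  classical
  induction φ with
  | pred P ts =>
    choose s hs using fun i => termValue_congr_finite (M := M) (ts i)
    refine ⟨Finset.univ.biUnion fun i => (s i).toLeft, fun v v' h xs => ?_⟩
    simp only [value]
    congr 1
    funext i
    refine hs i _ _ fun j hj => ?_
    rcases j with j | j
    · exact h j (Finset.mem_biUnion.2 ⟨i, Finset.mem_univ i, by simpa using hj⟩)
    · rfl
  | connective c φs ih =>
    choose s hs using ih
    refine ⟨Finset.univ.biUnion s, fun v v' h xs => ?_⟩
    simp only [value]
    congr 1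
    funext i
    exact hs i v v' (fun j hj => h j (Finset.mem_biUnion.2 ⟨i, Finset.mem_univ i, hj⟩)) xs
  | sup φ ih =>
    obtain ⟨s, hs⟩ := ih
    exact ⟨s, fun v v' h xs => by simp only [value, hs v v' h]⟩
  | inf φ ih =>
    obtain ⟨s, hs⟩ := ih
    exact ⟨s, fun v v' h xs => by simp only [value, hs v v' h]⟩

/-! ### Limits along ultrafilters and the theorem of Łoś -/

theorem tendsto_ultraLim {I : Type u} (D : Ultrafilter I) (r : I → unitInterval) :
    Tendsto r D (𝓝 (ultraLim D r)) :=
  Ultrafilter.le_nhds_lim (D.map r)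

theorem ultraLim_eq_of_tendsto {I : Type u} {D : Ultrafilter I} {r : I → unitInterval}
    {s : unitInterval} (h : Tendsto r D (𝓝 s)) : ultraLim D r = s :=
  tendsto_nhds_unique (tendsto_ultraLim D r) h

theorem tendsto_coe_ultraLim {I : Type u} (D : Ultrafilter I) (r : I → unitInterval) :
    Tendsto (fun t => (r t : ℝ)) D (𝓝 (ultraLim D r : ℝ)) :=
  (continuous_subtype_val.tendsto _).comp (tendsto_ultraLim D r)

theorem ultraLim_iSup {I : Type u} (D : Ultrafilter I) {M : I → Type w} [∀ t, Nonempty (M t)]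
    (f : ∀ t, M t → unitInterval) :
    ⨆ y : ∀ t, M t, ultraLim D (fun t => f t (y t)) = ultraLim D fun t => ⨆ y, f t y := by
  apply le_antisymm
  · refine iSup_le fun y => le_of_tendsto_of_tendsto' (tendsto_ultraLim _ _)
      (tendsto_ultraLim _ _) fun t => le_iSup (f t) (y t)
  · refine Subtype.coe_le_coe.1 (le_of_forall_pos_le_add fun ε hε => ?_)
    choose y hy using fun t => exists_iSup_lt_coe_add (f t) hε
    refine le_trans ?_ (add_le_add_left (coe_le_iSup _ y) ε)
    exact le_of_tendsto_of_tendsto' (tendsto_coe_ultraLim D _)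
      ((tendsto_coe_ultraLim D _).add_const ε) fun t => (hy t).le

theorem ultraLim_iInf {I : Type u} (D : Ultrafilter I) {M : I → Type w} [∀ t, Nonempty (M t)]
    (f : ∀ t, M t → unitInterval) :
    ⨅ y : ∀ t, M t, ultraLim D (fun t => f t (y t)) = ultraLim D fun t => ⨅ y, f t y := by
  apply le_antisymm
  · refine Subtype.coe_le_coe.1 (le_of_forall_pos_le_add fun ε hε => ?_)
    choose y hy using fun t => exists_coe_lt_iInf_add (f t) hε
    refine (iInf_le_coe _ y).trans ?_
    exact le_of_tendsto_of_tendsto' (tendsto_coe_ultraLim D _)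
      ((tendsto_coe_ultraLim D _).add_const ε) fun t => (hy t).le
  · refine le_iInf fun y => le_of_tendsto_of_tendsto' (tendsto_ultraLim _ _)
      (tendsto_ultraLim _ _) fun t => iInf_le (f t) (y t)

theorem PreUltraproduct.termValue_apply {I : Type u} (D : Ultrafilter I) {M : I → Type w}
    [∀ t, RVStructure L (M t)] {α : Type x} (v : α → PreUltraproduct D M) (s : L.Term α) (t : I) :
    termValue v s t = termValue (fun i => v i t) s := by
  induction s with
  | var i => rfl
  | func f ts ih =>
    simp only [termValue, ← ih]
    rfl

/-- The theorem of Łoś: a formula is evaluated in the pre-ultraproduct coordinatewise, up to a limit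
along the ultrafilter. -/
theorem PreUltraproduct.value_eq {I : Type u} (D : Ultrafilter I) {M : I → Type w}
    [∀ t, RVStructure L (M t)] {α : Type x} (v : α → PreUltraproduct D M) {n : ℕ}
    (φ : BFormula L α n) (xs : Fin n → PreUltraproduct D M) :
    φ.value v xs = ultraLim D fun t => φ.value (fun i => v i t) fun i => xs i t := by
  have (t : I) : Nonempty (M t) := RVStructure.nonempty L
  have snoc : ∀ {n : ℕ} (xs : Fin n → PreUltraproduct D M) (y : PreUltraproduct D M) (t : I),
      (fun i => (Fin.snoc xs y : Fin (n + 1) → PreUltraproduct D M) i t) =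
        (Fin.snoc (fun i => xs i t) (y t) : Fin (n + 1) → M t) := by
    intro n xs y t
    funext i
    refine Fin.lastCases ?_ (fun j => ?_) i <;> simp
  induction φ with
  | pred P ts =>
    simp only [BFormula.value]
    change ultraLim D _ = _
    congr 1
    funext t
    congr 1
    funext i
    refine (PreUltraproduct.termValue_apply D _ _ t).trans ?_
    congr 1
    funext j
    rcases j with j | j <;> rfl
  | connective c φs ih =>
    simp only [BFormula.value, ih]
    refine (ultraLim_eq_of_tendsto ?_).symm
    exact (c.continuous.tendsto _).comp (tendsto_pi_nhds.2 fun i => tendsto_ultraLim D _)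
  | sup φ ih =>
    simp only [BFormula.value, ih, snoc]
    exact ultraLim_iSup D fun t y => φ.value (fun i => v i t) (Fin.snoc (fun i => xs i t) y)
  | inf φ ih =>
    simp only [BFormula.value, ih, snoc]
    exact ultraLim_iInf D fun t y => φ.value (fun i => v i t) (Fin.snoc (fun i => xs i t) y)

theorem PreUltraproduct.truth_eq {I : Type u} (D : Ultrafilter I) {M : I → Type w}
    [∀ t, RVStructure L (M t)] {α : Type x} (v : α → PreUltraproduct D M) (φ : CFormula L α) :
    φ.truth v = ultraLim D fun t => φ.truth fun i => v i t := by
  unfold CFormula.truth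
  rw [PreUltraproduct.value_eq]
  congr 1
  funext t
  congr 1
  funext i
  exact i.elim0

theorem PreUltraproduct.truth_sumElim {I : Type u} (D : Ultrafilter I) {M : I → Type w}
    [∀ t, RVStructure L (M t)] {α : Type x} {β : Type w'} (v : α → PreUltraproduct D M)
    (c : β → PreUltraproduct D M) (φ : CFormula L (α ⊕ β)) :
    φ.truth (Sum.elim v c) =
      ultraLim D fun t => φ.truth (Sum.elim (fun i => v i t) fun i => c i t) := by
  rw [PreUltraproduct.truth_eq]
  congr 1
  funext t
  congr 1
  funext i
  rcases i with i | i <;> rfl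

/-! ### A small dense set of formulas -/

/-- The symbols that label the nodes of a formula when only connectives from a countable dense set
are allowed: atomic formulas, pairs `(k, i)` for the `i`-th of the chosen `k`-ary connectives, and
the two quantifiers (`true` for the supremum, `false` for the infimum). -/
abbrev FormulaNode (L : FirstOrder.Language.{a, b}) (α : Type x) : Type (max a b x) :=
  (Σ n l : ℕ, L.Relations l × (Fin l → L.Term (α ⊕ Fin n))) ⊕ ((ℕ × ℕ) ⊕ Bool)

/-- The index set of the immediate subformulas at a node. -/
abbrev FormulaNode.Children {α : Type x} : FormulaNode L α → Type
  | .inl _ => Fin 0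
  | .inr (.inl p) => Fin p.1
  | .inr (.inr _) => Fin 1

instance {α : Type x} (p : FormulaNode L α) : Finite p.Children := by
  rcases p with p | p | p <;> simp only [FormulaNode.Children] <;> infer_instance

/-- The formula described by a well-founded tree of nodes. An atomic formula with the wrong number
of quantifiable variables is read as the constant `0`. -/
noncomputable def decodeFormula {α : Type x} :
    WType (FormulaNode.Children (L := L) (α := α)) → ∀ n : ℕ, BFormula L α n
  | .mk (.inl ⟨m, _, P, ts⟩) _, n =>
      if h : m = n then h ▸ BFormula.pred P ts else .connective (k := 0) (.const _ 0) Fin.elim0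
  | .mk (.inr (.inl (k, i))) g, n =>
      .connective (TopologicalSpace.denseSeq C(Fin k → unitInterval, unitInterval) i)
        fun j => decodeFormula (g j) n
  | .mk (.inr (.inr true)) g, n => .sup (decodeFormula (g (0 : Fin 1)) (n + 1))
  | .mk (.inr (.inr false)) g, n => .inf (decodeFormula (g (0 : Fin 1)) (n + 1))

/-- Up to a uniform error every formula is described by a tree of nodes: connectives are uniformly
continuous, and quantifiers do not increase uniform distances. -/
theorem exists_decodeFormula_near (M : Type w) [RVStructure L M] {α : Type x} {n : ℕ}
    (φ : BFormula L α n) : ∀ ε : ℝ, 0 < ε →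
      ∃ p : WType (FormulaNode.Children (L := L) (α := α)), ∀ (v : α → M) (xs : Fin n → M),
        |(φ.value v xs : ℝ) - (decodeFormula p n).value v xs| ≤ ε := by
  induction φ with
  | @pred n l P ts =>
    intro ε hε
    refine ⟨.mk (.inl ⟨n, l, P, ts⟩) Fin.elim0, fun v xs => ?_⟩
    simp [decodeFormula, hε.le]
  | @connective n k c φs ih =>
    intro ε hε
    obtain ⟨δ, hδ, hc⟩ := Metric.uniformContinuous_iff.1
      (CompactSpace.uniformContinuous_of_continuous c.continuous) (ε / 2) (half_pos hε)
    obtain ⟨i, hi⟩ := (TopologicalSpace.denseRange_denseSeq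
      C(Fin k → unitInterval, unitInterval)).exists_dist_lt c (half_pos hε)
    choose p hp using fun j => ih j (δ / 2) (half_pos hδ)
    refine ⟨.mk (.inr (.inl (k, i))) p, fun v xs => ?_⟩
    simp only [decodeFormula, BFormula.value]
    set y : Fin k → unitInterval := fun j => (φs j).value v xs
    set z : Fin k → unitInterval := fun j => (decodeFormula (p j) n).value v xs
    have hyz : dist y z < δ := by
      refine lt_of_le_of_lt ((dist_pi_le_iff (half_pos hδ).le).2 fun j => ?_) (half_lt_self hδ)
      exact hp j v xs
    have h1 : dist (c y) (c z) < ε / 2 := hc hyz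
    have h2 := (ContinuousMap.dist_apply_le_dist (f := c)
      (g := TopologicalSpace.denseSeq C(Fin k → unitInterval, unitInterval) i) z).trans_lt hi
    refine le_trans (dist_triangle (c y) (c z) _) ?_
    linarith
  | sup φ ih =>
    intro ε hε
    obtain ⟨p, hp⟩ := ih ε hε
    exact ⟨.mk (.inr (.inr true)) fun _ => p, fun v xs =>
      abs_iSup_sub_iSup_le hε.le fun y => hp v _⟩
  | inf φ ih =>
    intro ε hε
    obtain ⟨p, hp⟩ := ih ε hε
    exact ⟨.mk (.inr (.inr false)) fun _ => p, fun v xs =>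
      abs_iInf_sub_iInf_le hε.le fun y => hp v _⟩

theorem mk_formulaNode_le [Countable L.Symbols] (α : Type x) :
    #(FormulaNode L α) ≤ max ℵ₀ (lift.{max a b} #α) := by
  set κ : Cardinal.{max a b x} := max ℵ₀ (lift.{max a b} #α) with hκ
  have h0 : ℵ₀ ≤ κ := le_max_left _ _
  have hS : Countable ((Σ l, L.Functions l) ⊕ Σ l, L.Relations l) := ‹Countable L.Symbols›
  have hF : Countable (Σ l, L.Functions l) :=
    (Sum.inl_injective (β := Σ l, L.Relations l)).countable
  have hR : Countable (Σ l, L.Relations l) :=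
    (Sum.inr_injective (α := Σ l, L.Functions l)).countable
  have hterm : ∀ n, lift.{b} #(L.Term (α ⊕ Fin n)) ≤ κ := by
    intro n
    refine (Cardinal.lift_le.2 Language.Term.card_le).trans ?_
    rw [lift_max, lift_aleph0, mk_sum, mk_sum, lift_add, lift_add, lift_add]
    refine max_le h0 (add_le_of_le h0 (add_le_of_le h0 ?_ (le_trans ?_ h0)) (le_trans ?_ h0))
    · simp only [lift_lift]
      exact le_max_right _ _
    · simp
    · rw [lift_le_aleph0, lift_le_aleph0]
      exact mk_le_aleph0
  have hsig : ∀ {X : ℕ → Type (max a b x)}, (∀ n, #(X n) ≤ κ) → #(Σ n, X n) ≤ κ := by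
    intro X hX
    rw [mk_sigma]
    refine (sum_le_lift_mk_mul_iSup _).trans (mul_le_of_le h0 (by simpa using h0) (ciSup_le' hX))
  rw [mk_sum]
  refine add_le_of_le h0 ?_ ?_
  · rw [lift_id'.{0, max a b x}]
    refine hsig fun n => hsig fun l => ?_
    rw [mk_prod]
    refine mul_le_of_le h0 ?_ ?_
    · refine le_trans ?_ h0
      have : Countable (L.Relations l) := (sigma_mk_injective (i := l) (β := L.Relations)).countable
      simp
    · have e : lift.{b} #(Fin l → L.Term (α ⊕ Fin n)) =
          (lift.{b} #(L.Term (α ⊕ Fin n))) ^ l := by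
        rw [mk_arrow, lift_id'.{0, max a x}, lift_power]
        simp
      exact e.trans_le ((pow_le_pow_left' (hterm n) l).trans (power_nat_le h0))
  · refine le_trans ?_ h0
    simp

theorem exists_small_dense [Countable L.Symbols] (M : Type w) [RVStructure L M] (α : Type x) :
    ∃ S : Set (CFormula L α), #S ≤ max ℵ₀ (lift.{max a b} #α) ∧
      ∀ (φ : CFormula L α) (ε : ℝ), 0 < ε → ∃ ψ ∈ S, ∀ v : α → M,
        |(φ.truth v : ℝ) - ψ.truth v| ≤ ε := by
  refine ⟨Set.range fun p : WType (FormulaNode.Children (L := L) (α := α)) => decodeFormula p 0,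
    ?_, fun φ ε hε => ?_⟩
  · refine mk_range_le.trans (WType.cardinalMk_le_max_aleph0_of_finite'.trans ?_)
    rw [lift_id']
    exact max_le (mk_formulaNode_le α) (le_max_left _ _)
  · obtain ⟨p, hp⟩ := exists_decodeFormula_near M φ ε hε
    exact ⟨_, ⟨p, rfl⟩, fun v => hp v _⟩

/-- The formula `φ ∸ r`, whose value is `max (φ - r) 0` for `r ≥ 0`. -/
noncomputable def CFormula.truncSub {α : Type x} (r : ℝ) (φ : CFormula L α) : CFormula L α :=
  .connective (k := 1) ⟨fun y => Set.projIcc 0 1 zero_le_one ((y 0 : ℝ) - r), by fun_prop⟩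
    fun _ => φ

theorem CFormula.truth_truncSub_eq_zero {M : Type w} [RVStructure L M] {α : Type x} (r : ℝ)
    (φ : CFormula L α) (v : α → M) : (φ.truncSub r).truth v = 0 ↔ (φ.truth v : ℝ) ≤ r := by
  refine Iff.trans ?_ sub_nonpos
  exact projIcc_eq_zero

theorem CFormula.truth_lt_of_truncSub_lt {M : Type w} [RVStructure L M] {α : Type x} {r ε : ℝ}
    {φ : CFormula L α} {v : α → M} (hr : 0 ≤ r) (h : ((φ.truncSub r).truth v : ℝ) < ε) :
    (φ.truth v : ℝ) < r + ε := by
  have e : ((φ.truncSub r).truth v : ℝ) = max 0 (min 1 ((φ.truth v : ℝ) - r)) := rfl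
  have h1 := unitInterval.le_one (φ.truth v)
  rw [e, min_eq_right (by linarith)] at h
  linarith [le_max_right 0 ((φ.truth v : ℝ) - r)]

/-- In order to realize a type it suffices to realize types that consist of few formulas: a type `Γ`
is replaced by those formulas `ψ ∸ 1 / (k + 1)`, with `ψ` from a small dense set, that follow from
a single member of `Γ` in the given structure. -/
theorem exists_small_type [Countable L.Symbols] {M : Type w} [RVStructure L M] {A : Set M} {n : ℕ}
    (Γ : Set (CFormula L (A ⊕ Fin n))) (hΓ : FinitelySatisfiable Γ) :
    ∃ Γ' : Set (CFormula L (A ⊕ Fin n)), FinitelySatisfiable Γ' ∧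
      (Satisfiable Γ' → Satisfiable Γ) ∧ #Γ' ≤ max ℵ₀ (lift.{max a b} #A) := by
  obtain ⟨S, hS, hd⟩ := exists_small_dense (L := L) M (A ⊕ Fin n)
  let Γ' : Set (CFormula L (A ⊕ Fin n)) :=
    {θ | (∃ ψ ∈ S, ∃ k : ℕ, θ = ψ.truncSub (1 / (k + 1))) ∧
      ∃ φ ∈ Γ, ∀ v : A ⊕ Fin n → M, φ.truth v = 0 → θ.truth v = 0}
  refine ⟨Γ', ?_, ?_, ?_⟩
  · intro Δ hΔ hfin
    choose! f hf using fun θ (hθ : θ ∈ Γ') => hθ.2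
    obtain ⟨c, hc⟩ := hΓ (f '' Δ) (Set.image_subset_iff.2 fun θ hθ => (hf θ (hΔ hθ)).1)
      (hfin.image f)
    exact ⟨c, fun θ hθ => (hf θ (hΔ hθ)).2 _ (hc _ ⟨θ, hθ, rfl⟩)⟩
  · rintro ⟨c, hc⟩
    refine ⟨c, fun φ hφ => ?_⟩
    refine le_antisymm (Subtype.coe_le_coe.1 (le_of_forall_pos_le_add fun ε hε => ?_))
      unitInterval.nonneg'
    obtain ⟨k, hk⟩ := exists_nat_one_div_lt (half_pos hε)
    obtain ⟨ψ, hψ, hφψ⟩ := hd φ (1 / (k + 1)) Nat.one_div_pos_of_nat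
    have h1 := hc (ψ.truncSub (1 / (k + 1))) ⟨⟨ψ, hψ, k, rfl⟩, φ, hφ, fun v hv => by
      rw [CFormula.truth_truncSub_eq_zero]
      have := (abs_sub_le_iff.1 (hφψ v)).2
      simpa [hv] using this⟩
    rw [CFormula.truth_truncSub_eq_zero] at h1
    have h2 := (abs_sub_le_iff.1 (hφψ (Sum.elim (fun p : A => (p : M)) c))).1
    simp only [Set.Icc.coe_zero]
    linarith
  · have : Γ' ⊆ Set.range fun p : S × ℕ =>
        (p.1 : CFormula L (A ⊕ Fin n)).truncSub (1 / (p.2 + 1)) := by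
      rintro θ ⟨⟨ψ, hψ, k, rfl⟩, -⟩
      exact ⟨(⟨ψ, hψ⟩, k), rfl⟩
    refine (mk_le_mk_of_subset this).trans (mk_range_le.trans ?_)
    rw [mk_prod]
    have h0 : ℵ₀ ≤ max ℵ₀ (lift.{max a b} #A) := le_max_left _ _
    refine mul_le_of_le h0 ?_ (by simp)
    rw [lift_id'.{0, max a b w}]
    refine hS.trans (max_le h0 ?_)
    rw [mk_sum, lift_add]
    refine add_le_of_le h0 ?_ (le_trans ?_ h0)
    · simp
    · simp

/-! ### Transfer of finitely many formula values -/

/-- The formula `min 1 (∑ φ i)`. -/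
noncomputable def CFormula.finSum {α : Type x} {ι : Type u} [Fintype ι] (φ : ι → CFormula L α) :
    CFormula L α :=
  BFormula.finConnective ⟨fun y => Set.projIcc 0 1 zero_le_one (∑ i, (y i : ℝ)), by fun_prop⟩ φ

theorem CFormula.truth_finSum {M : Type w} [RVStructure L M] {α : Type x} {ι : Type u} [Fintype ι]
    (φ : ι → CFormula L α) (v : α → M) :
    (finSum φ).truth v = Set.projIcc 0 1 zero_le_one (∑ i, ((φ i).truth v : ℝ)) :=
  BFormula.value_finConnective _ _ _ _

theorem CFormula.truth_le_truth_finSum {M : Type w} [RVStructure L M] {α : Type x} {ι : Type u}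
    [Fintype ι] (φ : ι → CFormula L α) (v : α → M) (i : ι) :
    ((φ i).truth v : ℝ) ≤ (finSum φ).truth v := by
  have h : ((φ i).truth v : ℝ) ≤ ∑ i, ((φ i).truth v : ℝ) :=
    Finset.single_le_sum (f := fun i => ((φ i).truth v : ℝ))
      (fun i _ => unitInterval.nonneg _) (Finset.mem_univ i)
  rw [truth_finSum, Set.coe_projIcc]
  exact le_max_of_le_right (le_min (unitInterval.le_one _) h)

theorem CFormula.truth_finSum_eq_zero {M : Type w} [RVStructure L M] {α : Type x} {ι : Type u}
    [Fintype ι] {φ : ι → CFormula L α} {v : α → M} (h : ∀ i, (φ i).truth v = 0) :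
    (finSum φ).truth v = 0 := by
  rw [truth_finSum, projIcc_eq_zero]
  simp [h]

/-- The formula `|φ - r|`. -/
noncomputable def CFormula.absSub {α : Type x} (φ : CFormula L α) (r : unitInterval) :
    CFormula L α :=
  .connective (k := 1) ⟨fun y => Set.projIcc 0 1 zero_le_one |(y 0 : ℝ) - r|, by fun_prop⟩
    fun _ => φ

theorem CFormula.truth_absSub {M : Type w} [RVStructure L M] {α : Type x} (φ : CFormula L α)
    (r : unitInterval) (v : α → M) : ((φ.absSub r).truth v : ℝ) = |(φ.truth v : ℝ) - r| := by
  have e : (φ.absSub r).truth v = Set.projIcc 0 1 zero_le_one |(φ.truth v : ℝ) - r| := rfl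
  have h : |(φ.truth v : ℝ) - r| ≤ 1 := abs_sub_le_of_nonneg_of_le (unitInterval.nonneg _)
    (unitInterval.le_one _) (unitInterval.nonneg _) (unitInterval.le_one _)
  rw [e, Set.coe_projIcc, min_eq_right h, max_eq_right (abs_nonneg _)]

/-- Elementarily equivalent structures approximately realize the same values of any finite family
of formulas: as only finitely many of the variables matter, the possible values are described by
sentences. -/
theorem ElemEquiv.exists_near {M : Type w} {N : Type w'} [RVStructure L M] [RVStructure L N]
    (h : ElemEquiv L M N) {α : Type x} {ι : Type u} [Fintype ι] (ψ : ι → CFormula L α)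
    (v : α → N) {ε : ℝ} (hε : 0 < ε) :
    ∃ z : α → M, ∀ i, |((ψ i).truth z : ℝ) - (ψ i).truth v| < ε := by
  classical
  have := RVStructure.nonempty L (M := M)
  have hN := RVStructure.nonempty L (M := N)
  let χ : CFormula L α := CFormula.finSum fun i => (ψ i).absSub ((ψ i).truth v)
  have hχ : χ.truth v = 0 := CFormula.truth_finSum_eq_zero fun i => by
    rw [← Set.Icc.coe_eq_zero, CFormula.truth_absSub, sub_self, abs_zero]
  obtain ⟨s, hs⟩ := BFormula.value_congr_finite N χ
  -- One extra bound variable takes the place of all the variables that do not matter.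
  let f : α → Empty ⊕ Fin (s.card + 1) := fun i =>
    Sum.inr (if hi : i ∈ s then (s.equivFin ⟨i, hi⟩).castSucc else Fin.last _)
  let xs : Fin (s.card + 1) → N :=
    Fin.snoc (fun k => v (s.equivFin.symm k)) hN.some
  let σ : CSentence L := BFormula.infAll (BFormula.bind (m := s.card + 1) (n := 0) f χ)
  have hσN : CSentence.truthIn σ N = 0 := by
    refine le_antisymm ?_ unitInterval.nonneg'
    refine (BFormula.truth_infAll _ _).trans_le ((iInf_le _ xs).trans ?_)
    have e := BFormula.value_bind f χ (Empty.elim : Empty → N) xs Fin.elim0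
    rw [Fin.append_elim0] at e
    refine (e.trans ((hs _ v (fun i hi => ?_) _).trans hχ)).le
    simp [f, xs, hi]
  have hσM := (h σ).trans hσN
  obtain ⟨ys, hys⟩ := exists_coe_lt_iInf_add (fun ys : Fin (s.card + 1) → M =>
    (BFormula.bind (m := s.card + 1) (n := 0) f χ).value Empty.elim ys) hε
  rw [← BFormula.truth_infAll] at hys
  have e := BFormula.value_bind f χ (Empty.elim : Empty → M) ys Fin.elim0
  rw [Fin.append_elim0] at e
  have e0 : CFormula.truth σ (Empty.elim : Empty → M) = 0 := hσM
  refine ⟨Sum.elim Empty.elim ys ∘ f, fun i => ?_⟩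
  rw [← CFormula.truth_absSub]
  refine (CFormula.truth_le_truth_finSum
    (fun i => (ψ i).absSub ((ψ i).truth v)) _ i).trans_lt ?_
  have e1 : ((CFormula.truth χ (Sum.elim Empty.elim ys ∘ f) : unitInterval) : ℝ) < 0 + ε := by
    refine lt_of_eq_of_lt (congrArg Subtype.val e.symm) (lt_of_lt_of_eq hys ?_)
    rw [show BFormula.infAll _ = σ from rfl, e0]
    rfl
  simpa using e1

/-! ### Approximate satisfiability of finitely many conditions -/

/-- The formula that measures how far the conditions `φ j ≤ r j`, for `j` in a finite set, are from
being satisfiable by a single `n`-tuple. -/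
noncomputable def satFormula {α : Type x} {n : ℕ} {J : Type u} (φ : J → CFormula L (α ⊕ Fin n))
    (r : J → ℝ) (Δ : Finset J) : CFormula L α :=
  CFormula.infVars (CFormula.finSum fun j : Δ => (φ j).truncSub (r j))

theorem truth_satFormula_eq_zero {M : Type w} [RVStructure L M] {α : Type x} {n : ℕ} {J : Type u}
    {φ : J → CFormula L (α ⊕ Fin n)} {r : J → ℝ} {Δ : Finset J} {v : α → M} (c : Fin n → M)
    (h : ∀ j ∈ Δ, ((φ j).truth (Sum.elim v c) : ℝ) ≤ r j) :
    (satFormula φ r Δ).truth v = 0 := by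
  refine le_antisymm ?_ unitInterval.nonneg'
  refine (CFormula.truth_infVars _ _).trans_le ((iInf_le _ c).trans ?_)
  refine (CFormula.truth_finSum_eq_zero fun j => ?_).le
  rw [CFormula.truth_truncSub_eq_zero]
  exact h j j.2

theorem exists_of_truth_satFormula_lt {M : Type w} [RVStructure L M] {α : Type x} {n : ℕ}
    {J : Type u} {φ : J → CFormula L (α ⊕ Fin n)} {r : J → ℝ} {Δ : Finset J} {v : α → M} {ε : ℝ}
    (hr : ∀ j ∈ Δ, 0 ≤ r j) (h : ((satFormula φ r Δ).truth v : ℝ) < ε) :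
    ∃ c : Fin n → M, ∀ j ∈ Δ, ((φ j).truth (Sum.elim v c) : ℝ) < r j + ε := by
  have := RVStructure.nonempty L (M := M)
  rw [satFormula, CFormula.truth_infVars] at h
  obtain ⟨c, hc⟩ := exists_coe_lt_iInf_add (fun c : Fin n → M =>
    (CFormula.finSum fun j : Δ => (φ j).truncSub (r j)).truth (Sum.elim v c)) (sub_pos.2 h)
  rw [add_sub_cancel] at hc
  refine ⟨c, fun j hj => CFormula.truth_lt_of_truncSub_lt (hr j hj) ?_⟩
  exact (CFormula.truth_le_truth_finSum (fun j : Δ => (φ j).truncSub (r j)) _ ⟨j, hj⟩).trans_lt hc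

/-! ### Regular ultrafilters -/

/-- Regularity: any family of at most `|I|` objects can be distributed over `I` so that each index
receives finitely many of them and each object goes to almost all indices. -/
theorem IsRegularUltrafilter.exists_finset {I : Type u} {D : Ultrafilter I}
    (hD : IsRegularUltrafilter D) {J : Type x} (hJ : lift.{u} #J ≤ lift.{x} #I) :
    ∃ F : I → Finset J, ∀ j, ∀ᶠ t in D, j ∈ F t := by
  obtain ⟨X, hX, hcard, hfin⟩ := hD
  rw [← hcard] at hJ
  obtain ⟨e⟩ := lift_mk_le'.1 hJ
  have hF : ∀ t, {j | t ∈ (e j : Set I)}.Finite := by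
    intro t
    refine Set.Finite.of_finite_image ((hfin t).subset ?_)
      (Subtype.val_injective.comp e.injective).injOn
    rintro _ ⟨j, hj, rfl⟩
    exact ⟨(e j).2, hj⟩
  refine ⟨fun t => (hF t).toFinset, fun j => ?_⟩
  simpa using hX _ (e j).2

theorem IsRegularUltrafilter.exists_nat {I : Type u} [Infinite I] {D : Ultrafilter I}
    (hD : IsRegularUltrafilter D) : ∃ G : I → ℕ, ∀ k, ∀ᶠ t in D, k ≤ G t := by
  obtain ⟨F, hF⟩ := hD.exists_finset (J := ℕ) (by simp)
  exact ⟨fun t => (F t).sup id, fun k => (hF k).mono fun t ht => Finset.le_sup (f := id) ht⟩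

/-! ### Transfer of types between ultraproducts -/

theorem truth_eq_zero_of_forall_nat {r : unitInterval} (h : ∀ k : ℕ, (r : ℝ) ≤ 2 / (k + 1)) :
    r = 0 := by
  refine le_antisymm (Subtype.coe_le_coe.1 (le_of_forall_pos_le_add fun ε hε => ?_))
    unitInterval.nonneg'
  obtain ⟨k, hk⟩ := exists_nat_one_div_lt (half_pos hε)
  have e : (2 : ℝ) / (k + 1) = 2 * (1 / (k + 1)) := by ring
  have := h k
  simp only [Set.Icc.coe_zero]
  linarith

/-- The heart of the argument. At each index `t` only finitely many conditions matter, so the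
parameters can be replaced by elements of `M t` for which all the relevant sets of conditions are
about as satisfiable as they were in `N t`. -/
theorem exists_transfer_parameters {I : Type u} [Infinite I] {D : Ultrafilter I}
    (hD : IsRegularUltrafilter D) {M : I → Type w} {N : I → Type w'} [∀ t, RVStructure L (M t)]
    [∀ t, RVStructure L (N t)] (hMN : ∀ t, ElemEquiv L (M t) (N t)) {α : Type x} {n : ℕ}
    (Γ : Set (CFormula L (α ⊕ Fin n))) (hcard : lift.{u} #Γ ≤ lift.{max a b x} #I)
    (v : α → PreUltraproduct D N)
    (hΓ : ∀ Δ ⊆ Γ, Δ.Finite → ∃ c : Fin n → PreUltraproduct D N, ∀ φ ∈ Δ,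
      φ.truth (Sum.elim v c) = 0) :
    ∃ z : α → PreUltraproduct D M,
      (∀ Δ : Finset (Γ × ℕ), ∃ c : Fin n → PreUltraproduct D M, ∀ j ∈ Δ,
        (CFormula.truth j.1.1 (Sum.elim z c) : ℝ) ≤ 2 / (j.2 + 1)) ∧
      ∀ c : Fin n → PreUltraproduct D M, (∀ φ ∈ Γ, φ.truth (Sum.elim z c) = 0) →
        ∃ d : Fin n → PreUltraproduct D N, ∀ φ ∈ Γ, φ.truth (Sum.elim v d) = 0 := by
  classical
  have hJ : lift.{u} #(Γ × ℕ) ≤ lift.{max a b x} #I := by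
    have h0 : ℵ₀ ≤ lift.{max a b x} #I := by simp
    rw [mk_prod, lift_mul]
    exact mul_le_of_le h0 (by simpa using hcard) (by simp)
  obtain ⟨F, hF⟩ := hD.exists_finset hJ
  obtain ⟨G, hG⟩ := hD.exists_nat
  let r : Γ × ℕ → ℝ := fun j => 1 / (j.2 + 1)
  have hr : ∀ j, 0 < r j := fun j => Nat.one_div_pos_of_nat
  let ε : I → ℝ := fun t => 1 / (G t + 1)
  have hε : ∀ t, 0 < ε t := fun t => Nat.one_div_pos_of_nat
  have hεr : ∀ j, ∀ᶠ t in D, ε t ≤ r j := fun j =>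
    (hG j.2).mono fun t ht => Nat.one_div_le_one_div ht
  let φ : Γ × ℕ → CFormula L (α ⊕ Fin n) := fun j => j.1
  choose z hz using fun t => (hMN t).exists_near
    (fun Δ : (F t).powerset => satFormula φ r Δ.1) (fun i => v i t) (hε t)
  have hz' : ∀ t, ∀ Δ ⊆ F t, |((satFormula φ r Δ).truth (z t) : ℝ) -
      (satFormula φ r Δ).truth fun i => v i t| < ε t := fun t Δ hΔ =>
    hz t ⟨Δ, Finset.mem_powerset.2 hΔ⟩
  let z' : α → PreUltraproduct D M := fun i t => z t i
  refine ⟨z', fun Δ => ?_, fun c hc => ?_⟩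
  · obtain ⟨c, hc⟩ := hΓ ((fun j : Γ × ℕ => (j.1 : CFormula L (α ⊕ Fin n))) '' Δ)
      (by rintro _ ⟨j, -, rfl⟩; exact j.1.2) (Δ.finite_toSet.image _)
    -- Wherever the conditions in `Δ` are satisfiable in `N t`, they nearly are in `M t`.
    have key : ∀ t, ∃ d : Fin n → M t, (Δ ⊆ F t ∧ ∀ j ∈ Δ, ((φ j).truth
        (Sum.elim (fun i => v i t) fun i => c i t) : ℝ) ≤ r j) →
          ∀ j ∈ Δ, ((φ j).truth (Sum.elim (z t) d) : ℝ) < r j + ε t := by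
      intro t
      by_cases ht : Δ ⊆ F t ∧ ∀ j ∈ Δ, ((φ j).truth
        (Sum.elim (fun i => v i t) fun i => c i t) : ℝ) ≤ r j
      · have h1 := hz' t Δ ht.1
        rw [truth_satFormula_eq_zero _ ht.2, Set.Icc.coe_zero, sub_zero] at h1
        obtain ⟨d, hd⟩ := exists_of_truth_satFormula_lt (fun j _ => (hr j).le)
          (lt_of_abs_lt h1)
        exact ⟨d, fun _ => hd⟩
      · exact ⟨fun _ => (RVStructure.nonempty L (M := M t)).some, fun h => absurd h ht⟩
    choose d hd using key
    let d' : Fin n → PreUltraproduct D M := fun i t => d t i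
    refine ⟨d', fun j hj => ?_⟩
    rw [PreUltraproduct.truth_sumElim]
    refine le_of_tendsto (tendsto_coe_ultraLim D _) ?_
    have h1 : ∀ᶠ t in D, ∀ j ∈ Δ, j ∈ F t := (Finset.eventually_all Δ).2 fun j _ => hF j
    have h2 : ∀ᶠ t in D, ∀ j ∈ Δ, ((φ j).truth
        (Sum.elim (fun i => v i t) fun i => c i t) : ℝ) ≤ r j := by
      refine (Finset.eventually_all Δ).2 fun j hj => ?_
      have e := hc _ ⟨j, hj, rfl⟩
      rw [PreUltraproduct.truth_sumElim] at e
      have := tendsto_coe_ultraLim D fun t =>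
        (φ j).truth (Sum.elim (fun i => v i t) fun i => c i t)
      rw [e] at this
      exact this.eventually_le_const (hr j)
    filter_upwards [h1, h2, hεr j] with t ht1 ht2 ht3
    have h3 := hd t ⟨ht1, ht2⟩ j hj
    have e : (2 : ℝ) / (j.2 + 1) = r j + r j := by simp only [r]; ring
    rw [e]
    exact h3.le.trans (by linarith)
  · -- At `t`, realize in `N t` those conditions that `c` satisfies in `M t`.
    let Δ : ∀ t, Finset (Γ × ℕ) := fun t =>
      (F t).filter fun j => ((φ j).truth (Sum.elim (z t) fun i => c i t) : ℝ) ≤ r j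
    have key : ∀ t, ∃ d : Fin n → N t, ∀ j ∈ Δ t,
        ((φ j).truth (Sum.elim (fun i => v i t) d) : ℝ) < r j + ε t := by
      intro t
      have h1 := hz' t (Δ t) (Finset.filter_subset _ _)
      rw [truth_satFormula_eq_zero (fun i => c i t) fun j hj => (Finset.mem_filter.1 hj).2,
        Set.Icc.coe_zero, abs_sub_comm, sub_zero] at h1
      exact exists_of_truth_satFormula_lt (fun j _ => (hr j).le) (lt_of_abs_lt h1)
    choose d hd using key
    let d' : Fin n → PreUltraproduct D N := fun i t => d t i
    refine ⟨d', fun ψ hψ => truth_eq_zero_of_forall_nat fun k => ?_⟩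
    let j : Γ × ℕ := (⟨ψ, hψ⟩, k)
    rw [PreUltraproduct.truth_sumElim]
    refine le_of_tendsto (tendsto_coe_ultraLim D _) ?_
    have h2 : ∀ᶠ t in D, ((φ j).truth (Sum.elim (z t) fun i => c i t) : ℝ) ≤ r j := by
      have e := hc ψ hψ
      rw [PreUltraproduct.truth_sumElim] at e
      have := tendsto_coe_ultraLim D fun t => ψ.truth (Sum.elim (z t) fun i => c i t)
      rw [e] at this
      exact this.eventually_le_const (hr j)
    filter_upwards [hF j, h2, hεr j] with t ht1 ht2 ht3
    have h3 := hd t j (Finset.mem_filter.2 ⟨ht1, ht2⟩)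
    have e : (2 : ℝ) / (k + 1) = r j + r j := by simp only [r, j]; ring
    rw [e]
    exact h3.le.trans (by linarith)

/-- In a saturated structure types with parameters indexed by an arbitrary type are realized. -/
theorem IsSaturated.realize {M : Type w} [RVStructure L M] {κ : Cardinal.{w}}
    (hM : IsSaturated L M κ) {α : Type x} (z : α → M) (hz : #(Set.range z) < κ) {n : ℕ}
    (Γ : Set (CFormula L (α ⊕ Fin n)))
    (hΓ : ∀ Δ ⊆ Γ, Δ.Finite → ∃ c : Fin n → M, ∀ φ ∈ Δ, φ.truth (Sum.elim z c) = 0) :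
    ∃ c : Fin n → M, ∀ φ ∈ Γ, φ.truth (Sum.elim z c) = 0 := by
  let g : α ⊕ Fin n → Set.range z ⊕ Fin n := Sum.map (Set.rangeFactorization z) id
  have hg : ∀ (φ : CFormula L (α ⊕ Fin n)) (c : Fin n → M),
      (φ.relabel g).truth (Sum.elim (fun p : Set.range z => (p : M)) c) =
        φ.truth (Sum.elim z c) := by
    intro φ c
    rw [CFormula.truth_relabel]
    congr 1
    funext i
    rcases i with i | i <;> rfl
  obtain ⟨c, hc⟩ := hM (Set.range z) hz n (CFormula.relabel g '' Γ) (by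
    intro Δ hΔ hfin
    have := hfin.to_subtype
    choose f hf using fun θ : Δ => hΔ θ.2
    obtain ⟨c, hc⟩ := hΓ (Set.range f) (Set.range_subset_iff.2 fun θ => (hf θ).1)
      (Set.finite_range f)
    refine ⟨c, fun θ hθ => ?_⟩
    rw [show θ = (f ⟨θ, hθ⟩).relabel g from (hf ⟨θ, hθ⟩).2.symm, hg]
    exact hc _ ⟨_, rfl⟩)
  exact ⟨c, fun φ hφ => (hg φ c).symm.trans (hc _ ⟨φ, hφ, rfl⟩)⟩

/-- Saturation of pre-ultraproducts modulo a regular ultrafilter is transferred along pointwise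
elementary equivalence. -/
theorem IsSaturated.transfer [Countable L.Symbols] {I : Type u} [Infinite I] {D : Ultrafilter I}
    (hD : IsRegularUltrafilter D) {M : I → Type w} {N : I → Type w'} [∀ t, RVStructure L (M t)]
    [∀ t, RVStructure L (N t)] (hMN : ∀ t, ElemEquiv L (M t) (N t))
    (hM : IsSaturated L (PreUltraproduct D M) (succCard.{u, w} I)) :
    IsSaturated L (PreUltraproduct D N) (succCard.{u, w'} I) := by
  intro A hA n Γ₀ hΓ₀
  have hA' : #A ≤ lift.{w'} #I := Order.lt_succ_iff.1 hA
  obtain ⟨Γ, hΓ, hsat, hcard⟩ := exists_small_type Γ₀ hΓ₀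
  refine hsat ?_
  have hcard' : lift.{u} #Γ ≤ lift.{max a b u w'} #I := by
    have h1 : lift.{u} #Γ = #Γ := lift_id'.{u, max a b w' u} _
    rw [h1]
    refine hcard.trans (max_le (by simp) ?_)
    have := Cardinal.lift_le.{max a b}.2 hA'
    rw [lift_lift] at this
    refine this.trans_eq ?_
    rw [← lift_umax.{u, max a b w'}]
  obtain ⟨z, hz, hback⟩ := exists_transfer_parameters hD hMN Γ hcard'
    (fun p : A => (p : PreUltraproduct D N)) hΓ
  have hB : #(Set.range z) < succCard.{u, w} I := by
    refine Order.lt_succ_iff.2 ?_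
    rw [← Cardinal.lift_le.{max u w'}]
    refine mk_range_le_lift.trans ((Cardinal.lift_le.2 hA').trans_eq ?_)
    simp only [lift_lift]
  -- The conditions are weakened in such a way that they are finitely satisfiable.
  let θ : Γ × ℕ → CFormula L (A ⊕ Fin n) := fun j => CFormula.truncSub (2 / (j.2 + 1)) j.1.1
  obtain ⟨c, hc⟩ := hM.realize z hB (Set.range θ) (by
    intro Δ hΔ hfin
    have := hfin.to_subtype
    choose f hf using fun ψ : Δ => hΔ ψ.2
    obtain ⟨c, hc⟩ := hz (Set.finite_range f).toFinset
    refine ⟨c, fun ψ hψ => ?_⟩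
    rw [show ψ = θ (f ⟨ψ, hψ⟩) from (hf ⟨ψ, hψ⟩).symm, CFormula.truth_truncSub_eq_zero]
    exact hc _ (by simp))
  obtain ⟨d, hd⟩ := hback c fun φ hφ => truth_eq_zero_of_forall_nat fun k =>
    (CFormula.truth_truncSub_eq_zero _ _ _).1 (hc (θ (⟨φ, hφ⟩, k)) ⟨_, rfl⟩)
  exact ⟨d, hd⟩

/-! ### Reductions -/

theorem Reduction.termValue_mk {M : Type w} [RVStructure L M] {α : Type x} (v : α → M)
    (t : L.Term α) :
    termValue (fun i => Reduction.mk L (v i)) t = Reduction.mk L (termValue v t) := by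
  induction t with
  | var i => rfl
  | func f ts ih => simp only [termValue, ih, Reduction.funMap_mk]

theorem Reduction.mk_surjective {M : Type w} [RVStructure L M] :
    Function.Surjective (Reduction.mk L : M → Reduction L M) := fun p => ⟨p.rep, p.mk_rep⟩

theorem Reduction.value_mk {M : Type w} [RVStructure L M] {α : Type x} (v : α → M) {n : ℕ}
    (φ : BFormula L α n) (xs : Fin n → M) :
    φ.value (fun i => Reduction.mk L (v i)) (fun i => Reduction.mk L (xs i)) = φ.value v xs := by
  have snoc : ∀ {n : ℕ} (xs : Fin n → M) (y : M),
      (Fin.snoc (fun i => Reduction.mk L (xs i)) (Reduction.mk L y) :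
        Fin (n + 1) → Reduction L M) = fun i => Reduction.mk L
          ((Fin.snoc xs y : Fin (n + 1) → M) i) := by
    intro n xs y
    funext i
    refine Fin.lastCases ?_ (fun j => ?_) i <;> simp
  induction φ with
  | pred P ts =>
    simp only [BFormula.value]
    rw [← Reduction.predMap_mk (M := M)]
    congr 1
    funext i
    rw [← Reduction.termValue_mk (M := M)]
    congr 1
    funext j
    rcases j with j | j <;> rfl
  | connective c φs ih => simp only [BFormula.value, ih]
  | sup φ ih =>
    simp only [BFormula.value]
    rw [← Reduction.mk_surjective.iSup_comp]
    simp only [snoc, ih]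
  | inf φ ih =>
    simp only [BFormula.value]
    rw [← Reduction.mk_surjective.iInf_comp]
    simp only [snoc, ih]

theorem Reduction.truth_mk {M : Type w} [RVStructure L M] {α : Type x} (v : α → M)
    (φ : CFormula L α) : φ.truth (fun i => Reduction.mk L (v i)) = φ.truth v := by
  unfold CFormula.truth
  rw [← Reduction.value_mk (M := M)]
  congr 1
  funext i
  exact i.elim0

theorem Reduction.truth_sumElim {M : Type w} [RVStructure L M] {α : Type x} {β : Type w'}
    (v : α → M) (c : β → M) (φ : CFormula L (α ⊕ β)) :
    φ.truth (Sum.elim (fun i => Reduction.mk L (v i)) fun i => Reduction.mk L (c i)) =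
      φ.truth (Sum.elim v c) := by
  rw [← Reduction.truth_mk (M := M)]
  congr 1
  funext i
  rcases i with i | i <;> rfl

theorem isSaturated_reduction_iff {M : Type w} [RVStructure L M] {κ : Cardinal.{w}} :
    IsSaturated L (Reduction L M) κ ↔ IsSaturated L M κ := by
  have mk_rep : ∀ {β : Type} (c : β → Reduction L M),
      (fun i => Reduction.mk L (c i).rep) = c := fun c => funext fun i => (c i).mk_rep
  constructor
  · intro h A hA n Γ hΓ
    obtain ⟨c, hc⟩ := h.realize (fun p : A => Reduction.mk L (p : M)) (mk_range_le.trans_lt hA) Γ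
      (by
        intro Δ hΔ hfin
        obtain ⟨c, hc⟩ := hΓ Δ hΔ hfin
        exact ⟨fun i => Reduction.mk L (c i), fun φ hφ =>
          (Reduction.truth_sumElim _ _ _).trans (hc φ hφ)⟩)
    refine ⟨fun i => (c i).rep, fun φ hφ => ?_⟩
    rw [← Reduction.truth_sumElim (M := M), mk_rep]
    exact hc φ hφ
  · intro h A hA n Γ hΓ
    have e : (fun p : A => Reduction.mk L (p : Reduction L M).rep) =
        fun p : A => (p : Reduction L M) :=
      funext fun p => (p : Reduction L M).mk_rep
    obtain ⟨c, hc⟩ := h.realize (fun p : A => (p : Reduction L M).rep) (mk_range_le.trans_lt hA) Γ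
      (by
        intro Δ hΔ hfin
        obtain ⟨c, hc⟩ := hΓ Δ hΔ hfin
        refine ⟨fun i => (c i).rep, fun φ hφ => ?_⟩
        rw [← Reduction.truth_sumElim (M := M), mk_rep, e]
        exact hc φ hφ)
    refine ⟨fun i => Reduction.mk L (c i), fun φ hφ => ?_⟩
    rw [← hc φ hφ, ← Reduction.truth_sumElim (M := M), e]

/-! ### Models of a continuous theory -/

/-- A theory decides the value `r` of a sentence `φ`, since it contains the sentence `|φ - r|`. -/
theorem ContinuousTheory.IsModel.elemEquiv {T : ContinuousTheory.{a, b, w}} {M N : Type w}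
    [RVStructure T.L M] [RVStructure T.L N] (hM : T.IsModel M) (hN : T.IsModel N) :
    ElemEquiv T.L M N := by
  obtain ⟨K, hK, hT⟩ := T.exists_structure
  have key : ∀ {P : Type w} [RVStructure T.L P], T.IsModel P → ∀ φ : CSentence T.L,
      CSentence.truthIn φ P = CSentence.truthIn φ K := by
    intro P _ hP φ
    have h : CFormula.absSub φ (CSentence.truthIn φ K) ∈ T.sentences := by
      rw [hT]
      refine Set.Icc.coe_eq_zero.1 ((CFormula.truth_absSub _ _ _).trans ?_)
      rw [abs_eq_zero, sub_eq_zero]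
      rfl
    have h' := (CFormula.truth_absSub _ _ _).symm.trans (Set.Icc.coe_eq_zero.2 (hP _ h))
    rw [abs_eq_zero, sub_eq_zero] at h'
    exact Subtype.ext h'
  exact fun φ => (key hM φ).trans (key hN φ).symm

theorem ContinuousTheory.isModel_of_eq_th {T : ContinuousTheory.{a, b, w}} {M : Type w}
    [RVStructure T.L M] (h : T.sentences = Th T.L M) : T.IsModel M :=
  fun φ hφ => by rwa [h] at hφ

theorem ContinuousTheory.exists_model (T : ContinuousTheory.{a, b, w}) :
    ∃ (M : Type w) (_ : RVStructure T.L M), T.IsModel M := by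
  obtain ⟨M, _, h⟩ := T.exists_structure
  exact ⟨M, _, T.isModel_of_eq_th h⟩

theorem ContinuousTheory.IsMetricTheory.exists_model {T : ContinuousTheory.{a, b, w}}
    (hT : T.IsMetricTheory) :
    ∃ (M : Type w) (_ : RVStructure T.L M), T.IsModel M ∧ IsMetricStructure T.L M := by
  obtain ⟨M, _, hM, h⟩ := hT
  exact ⟨M, _, T.isModel_of_eq_th h, hM⟩

theorem Saturates.of_isModel {I : Type u} [Infinite I] {D : Ultrafilter I}
    (hD : IsRegularUltrafilter D) {T : ContinuousTheory.{a, b, w}} {M N : Type w}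
    [RVStructure T.L M] [RVStructure T.L N] (hM : T.IsModel M) (hN : T.IsModel N)
    (h : Saturates D T.L M) : Saturates D T.L N := by
  have := T.countable
  exact isSaturated_reduction_iff.2 (IsSaturated.transfer hD (fun _ => hM.elemEquiv hN)
    (isSaturated_reduction_iff.1 h))

/-- The relation between two theories can be read off from any one pair of models. -/
theorem SaturatedWhenever.of_isModel {T U : ContinuousTheory.{a, b, w}} {M M' N N' : Type w}
    [RVStructure T.L M] [RVStructure T.L M'] [RVStructure U.L N] [RVStructure U.L N']
    (hM : T.IsModel M) (hM' : T.IsModel M') (hN : U.IsModel N) (hN' : U.IsModel N')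
    (h : SaturatedWhenever.{a, b, u, w} T.L M U.L N) :
    SaturatedWhenever.{a, b, u, w} T.L M' U.L N' :=
  fun I _ D hD hs => Saturates.of_isModel hD hM hM' (h I D hD (Saturates.of_isModel hD hN' hN hs))

end RealValued

open RealValued
theorem mainTheorem1 :
    -- elementarily equivalent families have equally saturated pre-ultraproducts
    (∀ (L : FirstOrder.Language.{a, b}) [Countable L.Symbols] (I : Type u) [Infinite I]
        (D : Ultrafilter I) (M : I → Type w) (N : I → Type w')
        [∀ t, RVStructure L (M t)] [∀ t, RVStructure L (N t)],
        IsRegularUltrafilter D →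
        (∀ t, ElemEquiv L (M t) (N t)) →
        (IsSaturated L (PreUltraproduct D M)
            (succCard.{u, w} I) ↔
          IsSaturated L (PreUltraproduct D N)
            (succCard.{u, w'} I))) ∧
    -- whether a regular ultrafilter saturates a model depends only on the theory
    (∀ (T : ContinuousTheory.{a, b, w}) (I : Type u) [Infinite I] (D : Ultrafilter I),
        IsRegularUltrafilter D →
        (∀ (M N : Type w) [RVStructure T.L M] [RVStructure T.L N],
          T.IsModel M → T.IsModel N →
            (Saturates D T.L M ↔ Saturates D T.L N)) ∧
        (SaturatesTheory D T ↔
          ∃ (M : Type w) (_ : RVStructure T.L M),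
            T.IsModel M ∧ Saturates D T.L M)) ∧
    -- the relation is a pre-order on continuous theories
    (∀ T : ContinuousTheory.{a, b, w}, TriangleLE.{a, b, u, w} T T) ∧
    (∀ T U W : ContinuousTheory.{a, b, w}, TriangleLE.{a, b, u, w} T U →
        TriangleLE.{a, b, u, w} U W → TriangleLE.{a, b, u, w} T W) ∧
    -- the relation can be tested on the classes of ultrafilters that saturate the theories,
    -- and on a single pair of models
    (∀ T U : ContinuousTheory.{a, b, w},
        (TriangleLE.{a, b, u, w} T U ↔
          ∀ (I : Type u) [Infinite I] (D : Ultrafilter I), IsRegularUltrafilter D →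
            SaturatesTheory D U → SaturatesTheory D T) ∧
        (TriangleLE.{a, b, u, w} T U ↔
          ∃ (M : Type w) (_ : RVStructure T.L M)
            (N : Type w) (_ : RVStructure U.L N),
            T.IsModel M ∧ U.IsModel N ∧
              SaturatedWhenever.{a, b, u, w} T.L M U.L N)) ∧
    -- metric theories: the relation defined by metric models only is reflexive, and it is
    -- the restriction of the one above; it can be tested on a single pair of metric models
    (∀ T : ContinuousTheory.{a, b, w}, T.IsMetricTheory →
        MetricTriangleLE.{a, b, u, w} T T) ∧
    (∀ T U : ContinuousTheory.{a, b, w}, T.IsMetricTheory → U.IsMetricTheory →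
        (MetricTriangleLE.{a, b, u, w} T U ↔
          TriangleLE.{a, b, u, w} T U) ∧
        (MetricTriangleLE.{a, b, u, w} T U ↔
          ∃ (M : Type w) (_ : RVStructure T.L M)
            (N : Type w) (_ : RVStructure U.L N),
            T.IsModel M ∧ IsMetricStructure T.L M ∧
            U.IsModel N ∧ IsMetricStructure U.L N ∧
              SaturatedWhenever.{a, b, u, w} T.L M U.L N)) := by
  refine ⟨?_, ?_, ?_, ?_, ?_, ?_, ?_⟩
  · intro L _ I _ D M N _ _ hD h
    exact ⟨IsSaturated.transfer hD h, IsSaturated.transfer hD fun t φ => (h t φ).symm⟩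
  · intro T I _ D hD
    refine ⟨fun M N _ _ hM hN => ⟨.of_isModel hD hM hN, .of_isModel hD hN hM⟩, fun h => ?_, ?_⟩
    · obtain ⟨M, _, hM⟩ := T.exists_model
      exact ⟨M, _, hM, h M hM⟩
    · rintro ⟨M, _, hM, h⟩ N _ hN
      exact .of_isModel hD hM hN h
  · intro T M _ N _ hM hN I _ D hD h
    exact .of_isModel hD hN hM h
  · intro T U W hTU hUW M _ K _ hM hK I _ D hD h
    obtain ⟨N, _, hN⟩ := U.exists_model
    exact hTU M N hM hN I D hD (hUW N K hN hK I D hD h)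
  · intro T U
    refine ⟨⟨fun h I _ D hD hU M _ hM => ?_, fun h M _ N _ hM hN I _ D hD hs => ?_⟩,
      fun h => ?_, ?_⟩
    · obtain ⟨N, _, hN⟩ := U.exists_model
      exact h M N hM hN I D hD (hU N hN)
    · exact h I D hD (fun K _ hK => .of_isModel hD hN hK hs) M hM
    · obtain ⟨M, _, hM⟩ := T.exists_model
      obtain ⟨N, _, hN⟩ := U.exists_model
      exact ⟨M, _, N, _, hM, hN, h M N hM hN⟩
    · rintro ⟨M, _, N, _, hM, hN, h⟩ M' _ N' _ hM' hN'
      exact .of_isModel hM hM' hN hN' h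
  · intro T _ M _ N _ hM _ hN _ I _ D hD h
    exact .of_isModel hD hN hM h
  · intro T U hT hU
    obtain ⟨M, _, hM, hMm⟩ := hT.exists_model
    obtain ⟨N, _, hN, hNm⟩ := hU.exists_model
    refine ⟨⟨fun h M' _ N' _ hM' hN' => .of_isModel hM hM' hN hN' (h M N hM hMm hN hNm),
      fun h M _ N _ hM _ hN _ => h M N hM hN⟩,
      fun h => ⟨M, _, N, _, hM, hMm, hN, hNm, h M N hM hMm hN hNm⟩, ?_⟩
    rintro ⟨M₁, _, N₁, _, hM₁, -, hN₁, -, h⟩ M' _ N' _ hM' _ hN' _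
    exact .of_isModel hM₁ hM' hN₁ hN' h
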